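/- Let $A$ be a finite alphabet with $q$ symbols and let $n\ge 1$. For $\mathbf u=(u_0,\dots,u_{n-1})\in A^n$ let $\pi(\mathbf u)=((u_0,u_1),(u_1,u_2),\dots,(u_{n-2},u_{n-1}),(u_{n-1},u_0))$. The pair-distance of $\mathbf u,\mathbf v\in A^n$ is the Hamming distance $D_{\mathrm p}(\mathbf u,\mathbf v)=|\{i\in\mathbb Z/n\mathbb Z:(u_i,u_{i+1})\neq(v_i,v_{i+1})\}|$ of $\pi(\mathbf u)$ and $\pi(\mathbf v)$. An $(n,d)_q$-symbol-pair code is a set $\mathcal C\subseteq A^n$ with $\min\{D_{\mathrm p}(\mathbf u,\mathbf v):\mathbf u,\mathbf v\in\mathcal C,\ \mathbf u\ne\mathbf v\}=d$; it is called MDS if $|\mathcal C|=q^{\,n-d+2}$. Let $q\ge 4$ be a prime power. Then, over every alphabet of $q$ symbols, there exists an MDS $(n,n-1)_q$-symbol-pair code whenever (i) $q$ is odd, and $3\le n\le (q^2-1)/2-3$ or $n=(q^2-1)/2$; (ii) $q$ is even, and $3\le n\le q(q+2)/2-3$ or $n=q(q+2)/2$. In particular, MDS symbol-pair codes can have length $\Omega(q^2)$: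 there is an absolute constant $c>0$ such that for every prime power $q\ge 4$ there is an MDS $(n,n-1)_q$-symbol-pair code of some length $n\ge c\,q^2$. -/

import Mathlib

universe u

/-- The symbol-pair read vector
`π(u) = ((u_0,u_1), (u_1,u_2), …, (u_{n-2},u_{n-1}), (u_{n-1},u_0))` of `u ∈ A^n`.
Here `finRotate n` is the cyclic shift `i ↦ i + 1` of the `n` coordinates. -/
def pairRead {n : ℕ} {A : Type*} (u : Fin n → A) : Fin n → A × A :=
  fun i => (u i, u (finRotate n i))

theorem pairRead_apply {n : ℕ} [NeZero n] {A : Type*} (u : Fin n → A) (i : Fin n) :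
    pairRead u i = (u i, u (i + 1)) := by
  obtain ⟨m, rfl⟩ : ∃ m, n = m + 1 := Nat.exists_eq_succ_of_ne_zero (NeZero.ne n)
  simp [pairRead]

open Classical in
/-- The pair-distance `D_p(u, v)`: the Hamming distance of the symbol-pair read vectors. -/
noncomputable def pairDist {n : ℕ} {A : Type*} (u v : Fin n → A) : ℕ :=
  hammingDist (pairRead u) (pairRead v)

/-- The code `C ⊆ A^n` has pair-distance `d`, that is, `d` is the minimum of `D_p(u, v)` over all
pairs of distinct codewords; `C` is then an `(n, d)_q`-symbol-pair code, where `q = |A|`. -/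
def IsSymbolPairCode {n : ℕ} {A : Type*} (C : Set (Fin n → A)) (d : ℕ) : Prop :=
  IsLeast {k : ℕ | ∃ u ∈ C, ∃ v ∈ C, u ≠ v ∧ pairDist u v = k} d

/-- `C` is an MDS `(n, d)_q`-symbol-pair code, where `q = |A|`: it has pair-distance `d` and
exactly `q ^ (n - d + 2)` codewords. (A pair-distance never exceeds `n`, so the subtraction
`n - d` is not truncated.) -/
def IsMDSSymbolPairCode {n : ℕ} {A : Type*} [Fintype A] (C : Set (Fin n → A)) (d : ℕ) : Prop :=
  IsSymbolPairCode C d ∧ C.ncard = Fintype.card A ^ (n - d + 2)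

/-- There exists an MDS `(n, d)_q`-symbol-pair code. The choice of the alphabet of `q` symbols does
not matter: a code is asked for over each of them. -/
def ExistsMDSSymbolPairCode (n d q : ℕ) : Prop :=
  ∀ (A : Type u) [Fintype A], Fintype.card A = q →
    ∃ C : Set (Fin n → A), IsMDSSymbolPairCode C d

/-!
The codes are linear. Over an alphabet made into a field `K = 𝔽_q`, the codewords are the values
`(x ⬝ p 0, …, x ⬝ p (n - 1))`, for `x ∈ K ^ 3`, at `n` fixed points of the projective plane over
`K`. If consecutive points, in cyclic order, are distinct, then the difference of two codewords
vanishes in positions `i` and `i + 1` exactly when it is given by the line joining those two points.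
So if the joining lines are pairwise distinct, that is, if the points form a closed trail of length
`n` (`IsClosedTrail`), the `q ^ 3` codewords have pair-distance exactly `n - 1`
(`exists_isMDSSymbolPairCode_of_isClosedTrail`).

Closed trails come from the Singer cycle. Identify `K ^ 3` with a cubic extension of `K`, and let `α`
generate its multiplicative group. The lines joining the points `α ^ i` and `α ^ (i + 1)` are
pairwise distinct for `0 ≤ i < q ^ 2 + q + 1` (`exists_singer_trail`). Take the first `n - 1` of
them. One further line `m`, meeting the first and the last of these, turns them into a closed trail
as soon as it is new and avoids three points; counting lines through these points shows that such an
`m` exists when `n < q ^ 2 - 2 * q + 5` (`exists_line_closing_trail`). For `q ≥ 4` this covers every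
`n` with `3 ≤ n ≤ q * (q + 2) / 2`, and so all the lengths in question, for odd and even `q` alike.
-/

/-! ### Closing a trail in a projective plane -/

/-- A closed trail in a point-line configuration: `n` points in cyclic order, consecutive ones distinct,
whose joining lines `l i` (through `p i` and its cyclic successor) are pairwise distinct. -/
def IsClosedTrail {P L : Type*} [Membership P L] {n : ℕ} (p : Fin n → P) (l : Fin n → L) : Prop :=
  Function.Injective l ∧ ∀ i, p i ∈ l i ∧ p (finRotate n i) ∈ l i ∧ p i ≠ p (finRotate n i)

open Configuration Projectivization in
/-- In a projective plane of order `r`, a trail of `k + 1` distinct lines `l 0, …, l k`, where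
consecutive lines meet in the points `p 1, …, p k`, can be closed up by one further line `m`
when `k` is small. All that is asked of `m` is that it be new and avoid `p 1`, `p k` and the common
point of `l 0` and `l k`, and there are fewer than `r ^ 2 + r + 1` lines violating this. -/
theorem exists_line_closing_trail {P L : Type*} [Membership P L] [ProjectivePlane P L]
    [Fintype P] [Fintype L] (p : ℕ → P) (l : ℕ → L) (hp : ∀ i, p i ∈ l i)
    (hp' : ∀ i, p (i + 1) ∈ l i) {k : ℕ} (hk : 1 ≤ k) (hl : Set.InjOn l (Set.Iic k))
    (hcard : k + 3 * ProjectivePlane.order P L <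
      ProjectivePlane.order P L ^ 2 + ProjectivePlane.order P L + 3) :
    ∃ (x y : P) (m : L), (∀ i ≤ k, l i ≠ m) ∧ x ∈ l k ∧ x ∈ m ∧ y ∈ m ∧ y ∈ l 0 ∧
      p k ≠ x ∧ x ≠ y ∧ y ≠ p 1 := by
  classical
  set r := ProjectivePlane.order P L with hr
  have h0k : l 0 ≠ l k := fun h => by
    have := hl (Set.mem_Iic.2 (Nat.zero_le k)) (Set.mem_Iic.2 le_rfl) h
    omega
  obtain ⟨z, hz0, hzk⟩ : ∃ z : P, z ∈ l 0 ∧ z ∈ l k :=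
    ⟨HasPoints.mkPoint h0k, HasPoints.mkPoint_ax h0k⟩
  let pencil : P → Finset L := fun a => Finset.univ.filter fun m => a ∈ m
  have hpencil : ∀ a, (pencil a).card = r + 1 := fun a => by
    rw [hr, ← ProjectivePlane.lineCount_eq L a, lineCount, Nat.card_eq_fintype_card,
      Fintype.card_subtype]
  -- In the pencils of `p 1` and `p k`, two lines each are already counted elsewhere.
  have hsdiff : ∀ a i j, i ≤ k → j ≤ k → i ≠ j → a ∈ l i → a ∈ l j →
      (pencil a \ {l i, l j}).card = r - 1 := fun a i j hi hj hij hai haj => by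
    have hne : l i ≠ l j := fun h => hij (hl (Set.mem_Iic.2 hi) (Set.mem_Iic.2 hj) h)
    rw [Finset.card_sdiff_of_subset, hpencil, Finset.card_pair hne]
    · omega
    · intro m hm
      rcases Finset.mem_insert.1 hm with rfl | hm
      · simpa [pencil] using hai
      · rw [Finset.mem_singleton.1 hm]
        simpa [pencil] using haj
  let bad : Finset L := ((Finset.Ico 1 k).image l ∪ pencil z) ∪
    ((pencil (p 1) \ {l 0, l 1}) ∪ (pencil (p k) \ {l (k - 1), l k}))
  have hbad : bad.card < Fintype.card L := by
    have h1 : ((Finset.Ico 1 k).image l).card ≤ k - 1 := by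
      simpa using Finset.card_image_le (s := Finset.Ico 1 k) (f := l)
    have h2 := hsdiff (p 1) 0 1 (by omega) hk (by omega) (hp' 0) (hp 1)
    have h3 := hsdiff (p k) (k - 1) k (by omega) le_rfl (by omega)
      (by simpa [Nat.sub_add_cancel hk] using hp' (k - 1)) (hp k)
    have h4 := Finset.card_union_le ((Finset.Ico 1 k).image l) (pencil z)
    have h5 := Finset.card_union_le (pencil (p 1) \ {l 0, l 1}) (pencil (p k) \ {l (k - 1), l k})
    have h6 := Finset.card_union_le ((Finset.Ico 1 k).image l ∪ pencil z)
      ((pencil (p 1) \ {l 0, l 1}) ∪ (pencil (p k) \ {l (k - 1), l k}))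
    have h7 := hpencil z
    have h8 : 1 < r := ProjectivePlane.one_lt_order P L
    rw [ProjectivePlane.card_lines P L]
    change _ < r ^ 2 + r + 1
    change bad.card ≤ _ at h6
    omega
  obtain ⟨m, hm⟩ : ∃ m, m ∉ bad := by
    by_contra! h
    exact hbad.ne (Finset.card_eq_of_equiv_fin (Fintype.equivFinOfCardEq (by
      simp [Finset.eq_univ_iff_forall.2 h])))
  simp only [bad, Finset.mem_union, not_or, Finset.mem_image, Finset.mem_Ico, not_exists, not_and,
    Finset.mem_sdiff, Finset.mem_insert, Finset.mem_singleton, pencil, Finset.mem_filter,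
    Finset.mem_univ, true_and, not_not] at hm
  obtain ⟨⟨hmid, hz⟩, h1, hk'⟩ := hm
  have hnew : ∀ i ≤ k, l i ≠ m := by
    rintro i hi rfl
    rcases Nat.eq_zero_or_pos i with rfl | hi0
    · exact hz hz0
    · rcases hi.eq_or_lt with rfl | hik
      · exact hz hzk
      · exact hmid i ⟨hi0, hik⟩ rfl
  have hp1m : p 1 ∉ m := fun h => by
    by_cases e : m = l 0
    · exact hnew 0 (by omega) e.symm
    · exact hnew 1 hk (h1 h e).symm
  have hpkm : p k ∉ m := fun h => by
    by_cases e : m = l (k - 1)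
    · exact hnew (k - 1) (by omega) e.symm
    · exact hnew k le_rfl (hk' h e).symm
  obtain ⟨x, hxk, hxm⟩ : ∃ x : P, x ∈ l k ∧ x ∈ m :=
    ⟨HasPoints.mkPoint (hnew k le_rfl), HasPoints.mkPoint_ax _⟩
  obtain ⟨y, hy0, hym⟩ : ∃ y : P, y ∈ l 0 ∧ y ∈ m :=
    ⟨HasPoints.mkPoint (hnew 0 (Nat.zero_le k)), HasPoints.mkPoint_ax _⟩
  refine ⟨x, y, m, hnew, hxk, hxm, hym, hy0, ?_, ?_, ?_⟩
  · rintro rfl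
    exact hpkm hxm
  · rintro rfl
    rcases Nondegenerate.eq_or_eq hxk hzk hy0 hz0 with rfl | h
    · exact hz hxm
    · exact h0k h.symm
  · rintro rfl
    exact hp1m hym

open Configuration in
theorem exists_isClosedTrail_of_trail {P L : Type*} [Membership P L] [ProjectivePlane P L]
    [Fintype P] [Fintype L] (p : ℕ → P) (l : ℕ → L) (hp : ∀ i, p i ∈ l i)
    (hp' : ∀ i, p (i + 1) ∈ l i) (hne : ∀ i, p i ≠ p (i + 1)) {k : ℕ} (hk : 1 ≤ k)
    (hl : Set.InjOn l (Set.Iic k))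
    (hcard : k + 3 * ProjectivePlane.order P L <
      ProjectivePlane.order P L ^ 2 + ProjectivePlane.order P L + 3) :
    ∃ (a : Fin (k + 2) → P) (b : Fin (k + 2) → L), IsClosedTrail a b := by
  obtain ⟨x, y, m, hnew, hxk, hxm, hym, hy0, hkx, hxy, hy1⟩ :=
    exists_line_closing_trail p l hp hp' hk hl hcard
  -- The points are `p 1, …, p k, x, y` and the lines `l 1, …, l k, m, l 0`.
  refine ⟨fun i => if i.1 < k then p (i + 1) else if i.1 = k then x else y,
    fun i => if i.1 < k then l (i + 1) else if i.1 = k then m else l 0, ?_, fun i => ?_⟩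
  · have hl' : ∀ i j, i ≤ k → j ≤ k → l i = l j → i = j := fun i j hi hj h => hl hi hj h
    rintro ⟨i, hi⟩ ⟨j, hj⟩ hij
    simp only at hij
    ext
    simp only
    split_ifs at hij with h1 h2 h3 h4 h5 h6 h7
    · have := hl' _ _ (by omega) (by omega) hij
      omega
    · exact absurd hij (hnew _ (by omega))
    · have := hl' _ _ (by omega) (by omega) hij
      omega
    · exact absurd hij.symm (hnew _ (by omega))
    · omega
    · exact absurd hij.symm (hnew _ (by omega))
    · have := hl' _ _ (by omega) (by omega) hij
      omega
    · exact absurd hij (hnew _ (by omega))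
    · omega
  · have hrot : (finRotate (k + 2) i).1 = if i.1 = k + 1 then 0 else i.1 + 1 := by
      rw [finRotate_apply, Fin.val_add_one]
      simp [Fin.ext_iff]
    obtain ⟨i, hi⟩ := i
    simp only [hrot]
    rcases (by omega : i + 1 < k ∨ i + 1 = k ∨ i = k ∨ i = k + 1) with h | h | h | h
    · simp only [show i < k by omega, show i ≠ k + 1 by omega, h, if_true, if_false]
      exact ⟨hp _, hp' _, hne _⟩
    · subst h
      simp only [show i ≠ i + 1 + 1 by omega, Nat.lt_succ_self, lt_irrefl, if_true, if_false]
      exact ⟨hp _, hxk, hkx⟩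
    · subst h
      simp [hxm, hym, hxy]
    · subst h
      simp [hy0, hp' 0, hy1, show 0 < k by omega]

/-! ### The Singer cycle -/

/-- An element of order `q ^ 3 - 1` in a cubic extension `L` of `K = 𝔽_q` generates a Singer cycle:
two planes `a • ⟨1, α⟩` and `α ^ d • a • ⟨1, α⟩` in the `K`-space `L` are equal only if
`q ^ 2 + q + 1` divides `d`. Equality is expressed by a nonzero functional that vanishes on both. -/
theorem singer_dvd_of_functional {K L : Type*} [Field K] [Fintype K] [Field L]
    [Algebra K L] (α : L)
    (hα : orderOf α = Fintype.card K ^ 3 - 1)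
    (hlin : ∀ y : L, ∃ a b c : K, y = a • 1 + b • α + c • α ^ 2)
    (g : L →ₗ[K] K) (hg : g ≠ 0) (d : ℕ) (h0 : g 1 = 0) (h1 : g α = 0)
    (h2 : g (α ^ d) = 0) (h3 : g (α ^ (d + 1)) = 0) :
    Fintype.card K ^ 2 + Fintype.card K + 1 ∣ d := by
  have hg2 : g (α ^ 2) ≠ 0 := fun h => hg <| by
    ext y
    obtain ⟨a, b, c, rfl⟩ := hlin y
    simp [h0, h1, h]
  obtain ⟨a, b, c, hd⟩ := hlin (α ^ d)
  have hc : c = 0 := by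
    rw [hd] at h2
    simpa [h0, h1, hg2] using h2
  subst hc
  have hb : b = 0 := by
    have : α ^ (d + 1) = a • α + b • α ^ 2 := by
      rw [pow_succ, hd]
      simp only [Algebra.smul_def, map_zero]
      ring
    rw [this] at h3
    simpa [h1, hg2] using h3
  subst hb
  -- Now `α ^ d` is a scalar, so `α ^ (d * (q - 1)) = 1`.
  have hq : 1 < Fintype.card K := Fintype.one_lt_card
  have hq3 : 1 < Fintype.card K ^ 3 := Nat.one_lt_pow (by norm_num) hq
  have hα0 : α ≠ 0 := by
    rintro rfl
    simp at hα
    omega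
  have ha : a ≠ 0 := by
    rintro rfl
    exact pow_ne_zero d hα0 (by simpa using hd)
  have hpow : α ^ (d * (Fintype.card K - 1)) = 1 := by
    rw [pow_mul, hd, zero_smul, zero_smul, add_zero, add_zero, Algebra.smul_def, mul_one, ← map_pow,
      FiniteField.pow_card_sub_one_eq_one a ha, map_one]
  have hdvd := orderOf_dvd_of_pow_eq_one hpow
  obtain ⟨t, ht⟩ : ∃ t, Fintype.card K = t + 1 := ⟨_, (Nat.sub_add_cancel hq.le).symm⟩
  have hfac : Fintype.card K ^ 3 - 1 =
      (Fintype.card K ^ 2 + Fintype.card K + 1) * (Fintype.card K - 1) := by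
    rw [ht, Nat.add_sub_cancel, Nat.sub_eq_iff_eq_add (Nat.one_le_pow _ _ (by omega))]
    ring
  rw [hα, hfac] at hdvd
  exact Nat.dvd_of_mul_dvd_mul_right (by omega) hdvd

/-- A cubic extension of `𝔽_q` with a generator `α` of its multiplicative group, for which
`1, α, α ^ 2` span and `1, α` are independent. -/
theorem exists_cubic_extension_singer (K : Type*) [Field K] [Fintype K] :
    ∃ (L : Type) (_ : Field L) (_ : Algebra K L) (α : L), Module.finrank K L = 3 ∧
      orderOf α = Fintype.card K ^ 3 - 1 ∧
      (∀ y : L, ∃ a b c : K, y = a • 1 + b • α + c • α ^ 2) ∧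
      ∀ a b : K, a • 1 + b • α = 0 → a = 0 ∧ b = 0 := by
  classical
  obtain ⟨p, hp⟩ := CharP.exists K
  have : Fact p.Prime := ⟨CharP.char_is_prime K p⟩
  let L := FiniteField.Extension K p 3
  have hfin : Module.finrank K L = 3 := FiniteField.finrank_extension K p 3
  obtain ⟨u, hu⟩ := IsCyclic.exists_generator (α := Lˣ)
  have hord : orderOf (u : L) = Fintype.card K ^ 3 - 1 := by
    rw [orderOf_units, orderOf_eq_card_of_forall_mem_zpowers hu, Nat.card_units,
      FiniteField.natCard_extension, Nat.card_eq_fintype_card]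
  have htop : IntermediateField.adjoin K {(u : L)} = ⊤ := by
    rw [eq_top_iff]
    rintro y -
    by_cases hy : y = 0
    · rw [hy]
      exact zero_mem _
    · obtain ⟨i, hi⟩ := Subgroup.mem_zpowers_iff.1 (hu (Units.mk0 y hy))
      have : y = (u : L) ^ i := by
        rw [← Units.val_zpow_eq_zpow_val, hi, Units.val_mk0]
      rw [this]
      exact zpow_mem (IntermediateField.mem_adjoin_simple_self K (u : L)) i
  have hdeg : (minpoly K (u : L)).natDegree = 3 := by
    rw [← IntermediateField.adjoin.finrank (Algebra.IsIntegral.isIntegral (u : L)), htop,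
      IntermediateField.finrank_top', hfin]
  have hind : LinearIndependent K fun i : Fin 3 => (u : L) ^ (i : ℕ) := by
    have := linearIndependent_pow (K := K) (u : L)
    rwa [hdeg] at this
  refine ⟨L, inferInstance, inferInstance, u, hfin, hord, fun y => ?_, fun a b hab => ?_⟩
  · let B := basisOfLinearIndependentOfCardEqFinrank hind (by simp [hfin])
    refine ⟨B.repr y 0, B.repr y 1, B.repr y 2, ?_⟩
    conv_lhs => rw [← B.sum_repr y]
    simp [Fin.sum_univ_three, B]
  · have := Fintype.linearIndependent_iff.1 hind ![a, b, 0]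
      (by simpa [Fin.sum_univ_three] using hab)
    exact ⟨this 0, this 1⟩

open Configuration Projectivization LinearAlgebra.Projectivization in
/-- The Singer cycle of the projective plane over `𝔽_q`, read as a trail: it joins consecutive
points by `q ^ 2 + q + 1` different lines before repeating itself. -/
theorem exists_singer_trail (K : Type*) [Field K] [Fintype K] [DecidableEq K] :
    ∃ p l : ℕ → ℙ K (Fin 3 → K), (∀ i, p i ∈ l i) ∧ (∀ i, p (i + 1) ∈ l i) ∧
      (∀ i, p i ≠ p (i + 1)) ∧
      Set.InjOn l (Set.Iio (Fintype.card K ^ 2 + Fintype.card K + 1)) := by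
  obtain ⟨L, _, _, α, hfin, hord, hlin, hind⟩ := exists_cubic_extension_singer K
  have hα0 : α ≠ 0 := by
    rintro rfl
    simpa using hind 0 1 (by simp)
  have : FiniteDimensional K L := Module.finite_of_finrank_eq_succ hfin
  let e : L ≃ₗ[K] (Fin 3 → K) := LinearEquiv.ofFinrankEq _ _ (by simp [hfin])
  have he : ∀ i, e (α ^ i) ≠ 0 := fun i => by simp [hα0]
  let p : ℕ → ℙ K (Fin 3 → K) := fun i => mk K (e (α ^ i)) (he i)
  have hne : ∀ i, p i ≠ p (i + 1) := fun i h => by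
    obtain ⟨c, hc⟩ := (mk_eq_mk_iff' K _ _ (he i) (he (i + 1))).1 h
    rw [← map_smul, e.injective.eq_iff, pow_succ', ← smul_mul_assoc] at hc
    have := mul_right_cancel₀ (pow_ne_zero i hα0) (hc.trans (one_mul _).symm)
    have := hind 1 (-c) (by simp [this])
    simp at this
  have hl1 : ∀ i, p i ∈ HasLines.mkLine (L := ℙ K (Fin 3 → K)) (hne i) :=
    fun i => (HasLines.mkLine_ax (hne i)).1
  have hl2 : ∀ i, p (i + 1) ∈ HasLines.mkLine (L := ℙ K (Fin 3 → K)) (hne i) :=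
    fun i => (HasLines.mkLine_ax (hne i)).2
  refine ⟨p, fun i => HasLines.mkLine (L := ℙ K (Fin 3 → K)) (hne i), hl1, hl2, hne, ?_⟩
  have key : ∀ i d, HasLines.mkLine (L := ℙ K (Fin 3 → K)) (hne i) = HasLines.mkLine (hne (i + d)) →
      Fintype.card K ^ 2 + Fintype.card K + 1 ∣ d := fun i d h => by
    have a1 := hl1 i
    have a2 := hl2 i
    have a3 := hl1 (i + d)
    have a4 := hl2 (i + d)
    rw [← h] at a3 a4
    generalize HasLines.mkLine (L := ℙ K (Fin 3 → K)) (hne i) = w at *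
    induction w with | h w hw =>
    simp only [ofField.mem_iff, p, orthogonal_mk] at a1 a2 a3 a4
    let f : L →ₗ[K] K := (dotProductBilin K K).flip w ∘ₗ e.toLinearMap
    have hf : ∀ y, f y = e y ⬝ᵥ w := fun y => rfl
    have hf0 : f ≠ 0 := fun h0 => hw <| by
      refine dotProduct_eq_zero w fun v => ?_
      rw [dotProduct_comm, ← e.apply_symm_apply v, ← hf, h0, LinearMap.zero_apply]
    refine singer_dvd_of_functional α hord hlin
      (f ∘ₗ LinearMap.mulLeft K (α ^ i)) (fun h0 => hf0 ?_) d ?_ ?_ ?_ ?_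
    · ext y
      have := LinearMap.congr_fun h0 ((α ^ i)⁻¹ * y)
      simpa [mul_inv_cancel_left₀ (pow_ne_zero i hα0)] using this
    all_goals simp only [LinearMap.comp_apply, LinearMap.mulLeft_apply, hf]
    · simpa using a1
    · simpa [pow_succ] using a2
    · simpa [pow_add] using a3
    · simpa [pow_add, mul_assoc] using a4
  have key' : ∀ i j, i ≤ j → j < Fintype.card K ^ 2 + Fintype.card K + 1 →
      HasLines.mkLine (L := ℙ K (Fin 3 → K)) (hne i) = HasLines.mkLine (hne j) → i = j := by
    intro i j hij hj h
    obtain ⟨d, rfl⟩ := Nat.exists_eq_add_of_le hij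
    have := Nat.eq_zero_of_dvd_of_lt (key i d h) (by omega)
    omega
  intro i hi j hj h
  rcases le_total i j with hij | hij
  · exact key' i j hij hj h
  · exact (key' j i hij hi h.symm).symm

open Configuration LinearAlgebra.Projectivization in
theorem order_projectivization (K : Type*) [Field K] [Fintype K] [DecidableEq K] :
    ProjectivePlane.order (ℙ K (Fin 3 → K)) (ℙ K (Fin 3 → K)) = Fintype.card K := by
  classical
  have := Fintype.ofFinite (ℙ K (Fin 3 → K))
  have h := ProjectivePlane.card_points (ℙ K (Fin 3 → K)) (ℙ K (Fin 3 → K))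
  have h' := Projectivization.card_of_finrank K (Fin 3 → K) (n := 3) (by simp)
  rw [Nat.card_eq_fintype_card, h] at h'
  simp only [Finset.sum_range_succ, Finset.sum_range_zero, Nat.card_eq_fintype_card] at h'
  nlinarith

/-! ### The code of a closed trail -/

open Configuration Projectivization LinearAlgebra.Projectivization in
/-- Evaluating the linear forms on `K ^ 3` at the points of a closed trail gives an MDS code: two
different forms agree at both ends of a line exactly when that line is the zero set of their
difference, and at most one line of the trail is. -/
theorem exists_isMDSSymbolPairCode_of_isClosedTrail {K : Type*} [Field K] [Fintype K]
    {n : ℕ} (hn : 2 ≤ n) {p l : Fin n → ℙ K (Fin 3 → K)} (h : IsClosedTrail p l) :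
    ∃ C : Set (Fin n → K), IsMDSSymbolPairCode C (n - 1) := by
  classical
  obtain ⟨hl, hp⟩ := h
  let c : (Fin 3 → K) → Fin n → K := fun x i => (p i).rep ⬝ᵥ x
  have hagree : ∀ x y (hxy : x - y ≠ 0) i,
      pairRead (c x) i = pairRead (c y) i ↔ l i = mk K (x - y) hxy := by
    intro x y hxy i
    have hmem : ∀ j, c x j = c y j ↔ p j ∈ mk K (x - y) hxy := fun j => by
      rw [ofField.mem_iff]
      conv_rhs => rw [← (p j).mk_rep]
      rw [orthogonal_mk (p j).rep_nonzero hxy, dotProduct_sub, sub_eq_zero]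
    obtain ⟨h1, h2, h3⟩ := hp i
    rw [pairRead, pairRead, Prod.mk.injEq, hmem, hmem]
    refine ⟨fun ⟨h4, h5⟩ => (Nondegenerate.eq_or_eq h1 h2 h4 h5).resolve_left h3, fun h => ?_⟩
    exact h ▸ ⟨h1, h2⟩
  have hdist : ∀ u v : Fin n → K, pairDist u v +
      (Finset.univ.filter fun i => pairRead u i = pairRead v i).card = n := fun u v => by
    have := Finset.card_filter_add_card_filter_not (s := (Finset.univ : Finset (Fin n)))
      (fun i => pairRead u i = pairRead v i)
    rw [Finset.card_univ, Fintype.card_fin, add_comm] at this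
    refine Eq.trans (congrArg (· + _) ?_) this
    rw [pairDist, hammingDist]
  have hle : ∀ x y, x ≠ y → n - 1 ≤ pairDist (c x) (c y) := fun x y hxy => by
    have h1 := hdist (c x) (c y)
    have h2 : (Finset.univ.filter fun i => pairRead (c x) i = pairRead (c y) i).card ≤ 1 := by
      refine Finset.card_le_one.2 fun i hi j hj => hl ?_
      rw [Finset.mem_filter, hagree x y (sub_ne_zero.2 hxy)] at hi hj
      rw [hi.2, hj.2]
    omega
  have hinj : Function.Injective c := fun x y hxy => by
    by_contra hne
    have := hle x y hne
    rw [hxy, pairDist, hammingDist_self] at this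
    omega
  refine ⟨Set.range c, ⟨?_, ?_⟩, ?_⟩
  · -- The form whose zero set is the first line has pair-weight exactly `n - 1`.
    let i₀ : Fin n := ⟨0, by omega⟩
    have hne : (l i₀).rep ≠ 0 := (l i₀).rep_nonzero
    refine ⟨c (l i₀).rep, ⟨_, rfl⟩, c 0, ⟨_, rfl⟩, fun h => hne (hinj h),
      le_antisymm ?_ (hle _ _ hne)⟩
    have h1 := hdist (c (l i₀).rep) (c 0)
    have h2 : 0 < (Finset.univ.filter fun i =>
        pairRead (c (l i₀).rep) i = pairRead (c 0) i).card := by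
      refine Finset.card_pos.2 ⟨i₀, ?_⟩
      rw [Finset.mem_filter, hagree _ _ (by rwa [sub_zero])]
      simp [mk_rep]
    omega
  · rintro k ⟨_, ⟨x, rfl⟩, _, ⟨y, rfl⟩, hne, rfl⟩
    exact hle x y fun h => hne (h ▸ rfl)
  · rw [← Set.image_univ, Set.ncard_image_of_injective _ hinj, Set.ncard_univ,
      Nat.card_eq_fintype_card, Fintype.card_fun, Fintype.card_fin]
    congr 1
    omega

/-! ### Existence of the codes -/

open Configuration LinearAlgebra.Projectivization in
/-- The bound is what closing up a trail of `n - 1` lines of the Singer cycle requires. -/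
theorem existsMDSSymbolPairCode_of_lt {q n : ℕ} (hq : IsPrimePow q) (hn : 3 ≤ n)
    (hlt : n + 2 * q < q ^ 2 + 5) : ExistsMDSSymbolPairCode.{u} n (n - 1) q := by
  intro A _ hA
  classical
  subst hA
  obtain ⟨inst⟩ := Fintype.nonempty_field_iff.2 hq
  have := Fintype.ofFinite (ℙ A (Fin 3 → A))
  obtain ⟨k, rfl⟩ : ∃ k, n = k + 2 := ⟨n - 2, by omega⟩
  obtain ⟨p, l, h1, h2, h3, h4⟩ := exists_singer_trail A
  have hcard : k + 3 * Fintype.card A < Fintype.card A ^ 2 + Fintype.card A + 3 := by omega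
  obtain ⟨a, b, hab⟩ := exists_isClosedTrail_of_trail p l h1 h2 h3 (k := k) (by omega)
    (h4.mono fun i hi => by
      have := hq.two_le
      rw [Set.mem_Iic] at hi
      rw [Set.mem_Iio]
      omega)
    (by rwa [order_projectivization])
  exact exists_isMDSSymbolPairCode_of_isClosedTrail (by omega) hab

theorem existsMDSSymbolPairCode_of_le {q n : ℕ} (hq : IsPrimePow q) (hq4 : 4 ≤ q) (hn : 3 ≤ n)
    (hle : n ≤ q * (q + 2) / 2) : ExistsMDSSymbolPairCode.{u} n (n - 1) q := by
  refine existsMDSSymbolPairCode_of_lt hq hn ?_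
  have h2 : n * 2 ≤ q * (q + 2) := (Nat.le_div_iff_mul_le two_pos).1 hle
  obtain ⟨t, rfl⟩ := Nat.exists_eq_add_of_le hq4
  nlinarith

theorem mainTheorem4 :
    (∀ q : ℕ, IsPrimePow q → 4 ≤ q →
      (Odd q → ∀ n : ℕ,
        (3 ≤ n ∧ n ≤ (q ^ 2 - 1) / 2 - 3) ∨ n = (q ^ 2 - 1) / 2 →
          ExistsMDSSymbolPairCode.{u} n (n - 1) q) ∧
      (Even q → ∀ n : ℕ,
        (3 ≤ n ∧ n ≤ q * (q + 2) / 2 - 3) ∨ n = q * (q + 2) / 2 →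
          ExistsMDSSymbolPairCode.{u} n (n - 1) q)) ∧
    (∃ c : ℝ, 0 < c ∧ ∀ q : ℕ, IsPrimePow q → 4 ≤ q →
      ∃ n : ℕ, c * (q : ℝ) ^ 2 ≤ (n : ℝ) ∧ ExistsMDSSymbolPairCode.{u} n (n - 1) q) := by
  refine ⟨fun q hq hq4 => ⟨fun _ n hn => ?_, fun _ n hn => ?_⟩, 1 / 2, by norm_num,
    fun q hq hq4 => ⟨q * (q + 2) / 2, ?_, ?_⟩⟩
  · have h16 : 4 * 4 ≤ q ^ 2 := by rw [sq]; exact Nat.mul_le_mul hq4 hq4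
    have heq : q * (q + 2) = q ^ 2 + 2 * q := by ring
    exact existsMDSSymbolPairCode_of_le hq hq4 (by omega) (by omega)
  · have h16 : 4 * 4 ≤ q * (q + 2) := Nat.mul_le_mul hq4 (by omega)
    exact existsMDSSymbolPairCode_of_le hq hq4 (by omega) (by omega)
  · have h : q ^ 2 ≤ 2 * (q * (q + 2) / 2) := by
      have heq : q * (q + 2) = q ^ 2 + 2 * q := by ring
      omega
    have h' : (q : ℝ) ^ 2 ≤ 2 * ((q * (q + 2) / 2 : ℕ) : ℝ) := by exact_mod_cast h
    linarith
  · have h16 : 4 * 4 ≤ q * (q + 2) := Nat.mul_le_mul hq4 (by omega)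
    exact existsMDSSymbolPairCode_of_le hq hq4 (by omega) le_rfl
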